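/- Let $S\subset\mathbb{Z}$ be a non-empty finite set and let $w_b\in\mathbb{C}\setminus\{0\}$ $(b\in S)$ be weights (for example positive reals). Consider walks with steps $(1,b)$, $b\in S$; the weight of a walk is the product of the weights of its steps. A meander starting at level $j\ge 0$ is a walk starting at level $j$ that never goes below level $0$. Put $P(x)=\sum_{b\in S}w_bx^b$ and $c=\max(0,-\min S)$. Let $T(z)$, respectively $T_j(z)$, be the generating function of the total weight of all unconstrained walks, respectively of all meanders starting at level $j$, where $z$ marks the number of steps. Let $T_j(z,v)$ be the refinement of $T_j(z)$ in which $v$ marks the level of the endpoint relative to the starting level $j$, i.e. a meander ending at level $k$ contributes $v^{k-j}$. Write $h_f$ for the complete homogeneous symmetric polynomial of degree $f$ in $c$ variables. There is $\delta>0$, depending only on $S$ and the weights, such that the following holds for every complex $z$ with $0<|z|<\delta$. We have $1-zP(1)\ne 0$ and $T(z)=\frac{1}{1-zP(1)}$. The equation $1=zP(X)$ has exactly $c$ distinct solutions $X_1,\dots,X_c$ with $0<|X_\ell|<1$ (the small roots), and, for any numbering of them: 1. For every $j\ge 0$, $$T_j(z)=T(z)\Bigg(1-\sum_{\ell=1}^{c}\frac{\big(\prod_{1\le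 i<k\le c}(X_i-X_k)\big)\big|_{X_\ell=1}}{\prod_{1\le i<k\le c}(X_i-X_k)}\,X_\ell^{c+j}\Bigg)=\frac{1}{1-zP(1)}\sum_{f=0}^{j}h_f(X_1,\dots,X_c)\prod_{\ell=1}^{c}(1-X_\ell).$$ 2. For every $v\in\mathbb{C}\setminus\{0\}$ with $|z|\sum_{b\in S}|w_b||v|^b<1$ we have $1-zP(v)\neq 0$ and, for every $j\ge 0$, $$T_j(z,v)=\frac{1}{1-zP(v)}\sum_{f=0}^{j}h_f\Big(\frac{X_1}{v},\dots,\frac{X_c}{v}\Big)\prod_{\ell=1}^{c}\Big(1-\frac{X_\ell}{v}\Big);$$ for $j=0$ this is the formula of Banderier and Flajolet, $T_0(z,v)=\frac{1}{1-zP(v)}\prod_{\ell=1}^{c}\big(1-\frac{X_\ell}{v}\big)$. All the series in $z$ converge absolutely for these $z$ (and $v$). -/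

import Mathlib

open scoped LaurentPolynomial

noncomputable section

namespace LatticePath

/-- The number `c = -min S`, read as `0` when all steps are positive (in which case, as for
`min S = 0`, the boundary is never felt and there are no small roots). -/
def depth (S : Finset ℤ) (hS : S.Nonempty) : ℕ := (-(S.min' hS)).toNat

/-- The characteristic Laurent polynomial `P(x) = ∑ w_b x^b`, as a function of `x ≠ 0`. -/
def charP (S : Finset ℤ) (w : ℤ → ℂ) (x : ℂ) : ℂ := ∑ b ∈ S, w b * x ^ b

/-- All walks with `n` steps from `S`, given by the sequence of their vertical increments. -/
def walks (S : Finset ℤ) (n : ℕ) : Finset (Fin n → ℤ) := Fintype.piFinset fun _ => S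

/-- The level reached after the first `k` steps of a walk that starts at level `j`. -/
def level {n : ℕ} (j : ℕ) (p : Fin n → ℤ) (k : ℕ) : ℤ :=
  (j : ℤ) + ∑ i : Fin n with i.val < k, p i

/-- Meanders with `n` steps starting at level `j`: the walks that never go below level `0`. -/
def meanders (S : Finset ℤ) (j n : ℕ) : Finset (Fin n → ℤ) :=
  (walks S n).filter fun p : Fin n → ℤ => ∀ k : Fin (n + 1), 0 ≤ level j p k

/-- The weight of a walk: the product of the weights of its steps. -/
def weight (w : ℤ → ℂ) {n : ℕ} (p : Fin n → ℤ) : ℂ := ∏ i, w (p i)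

/-- The generating function `T(z)` of unconstrained walks, `z` marking the length. -/
def walkGF (S : Finset ℤ) (w : ℤ → ℂ) : PowerSeries ℂ :=
  PowerSeries.mk fun n => ∑ p ∈ walks S n, weight w p

/-- The generating function `T_j(z)` of meanders starting at level `j`. -/
def meanderGF (S : Finset ℤ) (w : ℤ → ℂ) (j : ℕ) : PowerSeries ℂ :=
  PowerSeries.mk fun n => ∑ p ∈ meanders S j n, weight w p

/-- The bivariate generating function `T_j(z, v)` of meanders starting at level `j`: a power
series in `z` whose coefficients are Laurent polynomials in `v`, where `v` marks the level of the
endpoint relative to the starting level `j`. -/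
def meanderGF₂ (S : Finset ℤ) (w : ℤ → ℂ) (j : ℕ) : PowerSeries ℂ[T;T⁻¹] :=
  PowerSeries.mk fun n => ∑ p ∈ meanders S j n,
    LaurentPolynomial.C (weight w p) * LaurentPolynomial.T (level j p n - j)

/-- The small roots at `z`: the solutions `x` of `1 = z P(x)` with `|x| < 1`. -/
def smallRoots (S : Finset ℤ) (w : ℤ → ℂ) (z : ℂ) : Set ℂ :=
  {x | x ≠ 0 ∧ ‖x‖ < 1 ∧ 1 = z * charP S w x}

/-- The product `∏_{i<k} (X_i - X_k)`. -/
def vdm {c : ℕ} (X : Fin c → ℂ) : ℂ := ∏ i, ∏ k ∈ Finset.Ioi i, (X i - X k)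

/-- The complete homogeneous symmetric polynomial `h_f` evaluated at `X_1, …, X_c`. -/
def hsym {c : ℕ} (f : ℕ) (X : Fin c → ℂ) : ℂ :=
  MvPolynomial.eval X (MvPolynomial.hsymm (Fin c) ℂ f)

end LatticePath

end

/-!
The proof is the kernel method, run as a verification instead of a derivation.

Removing the first step of a meander shows that `G j = v ^ j T_j(z, v)` satisfies, for `j ≥ 0`,
`G j = v ^ j + z ∑ w_b G (j + b)`, the sum being over the steps `b` with `j + b ≥ 0`. Conversely,
iterating this recursion `N` times expresses any solution as a partial sum of the generating
function plus a remainder (`sum_range_meanderSum`). If the solution is bounded by a multiple of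
`‖v‖ ^ k + 1`, the remainder tends to zero when `|z| ∑ |w_b| |v| ^ b < 1` and `|z| ∑ |w_b| < 1`
(`hasSum_meanderSum`). So it suffices to exhibit one such solution.

On all integers `k` the functions `v ^ k / (1 - z P(v))` and `X_l ^ k`, for a small root `X_l`,
solve the inhomogeneous and the homogeneous unrestricted recursion. The combination of them that
vanishes at the `c` levels `-c, …, -1` solves the restricted one, since no step descends by more
than `c`. Its coefficients are given by Lagrange interpolation of `x ^ m`, `m < c`, at the nodes
`X_l / v`, evaluated at `1`; Cramer's rule writes them as quotients of Vandermonde products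
(`sum_vdm_div_mul_pow`). This is carried out in `hasSum_meanderSum_zpow`; the case `v = 1` is the
first formula of the theorem.

The formulas with complete homogeneous symmetric polynomials follow from the identity
`1 - ∑ α_l Y_l ^ (c + j) = (∑_{f ≤ j} h_f(Y)) ∏ (1 - Y_l)`, in which `α_l` are the interpolation weights
(`one_sub_sum_eq_sum_hsym_mul_prod`), by comparing generating functions in `j`.

Finally, `1 = z P(x)` reads `x ^ c = z Q(x)` with `Q(x) = x ^ c P(x)` a polynomial, and `Q(0) ≠ 0`
if `c > 0`. Extracting a `c`-th root of `Q` near `0` and applying the inverse function theorem,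
the small roots correspond to the `c`-th roots of `z` (`exists_encard_roots_eq`).
-/

namespace LatticePath

/-! ### Interpolation weights and complete homogeneous symmetric polynomials -/

theorem mk_pow_mul_one_sub (a : ℂ) :
    (PowerSeries.mk fun k => a ^ k) * (1 - PowerSeries.C a * PowerSeries.X) = 1 := by
  ext n
  rw [mul_sub, mul_one, mul_comm (PowerSeries.C a), ← mul_assoc]
  cases n with
  | zero => simp
  | succ n => simp [PowerSeries.coeff_succ_mul_X, PowerSeries.coeff_one, pow_succ]

theorem mk_hsym_eq_prod {c : ℕ} (Y : Fin c → ℂ) :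
    (PowerSeries.mk fun f => hsym f Y) = ∏ l, PowerSeries.mk fun k => Y l ^ k := by
  ext d
  rw [PowerSeries.coeff_prod, PowerSeries.coeff_mk, hsym, MvPolynomial.hsymm, map_sum]
  simp only [PowerSeries.coeff_mk]
  refine Finset.sum_bij (fun s _ => Multiset.toFinsupp s.1) ?_ ?_ ?_ ?_
  · intro s _
    rw [Finset.mem_finsuppAntidiag]
    refine ⟨?_, Finset.subset_univ _⟩
    exact (Multiset.sum_count_eq_card fun l _ => Finset.mem_univ l).trans s.2
  · intro s _ t _ h
    exact Subtype.ext (Multiset.toFinsupp.injective h)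
  · intro p hp
    rw [Finset.mem_finsuppAntidiag] at hp
    refine ⟨⟨Finsupp.toMultiset p, ?_⟩, Finset.mem_univ _, by simp⟩
    rw [Finsupp.card_toMultiset, ← hp.1, Finsupp.sum_fintype _ _ (by simp)]
    simp
  · intro s _
    rw [← Multiset.prod_hom', Finset.prod_multiset_map_count]
    refine (Finset.prod_subset (Finset.subset_univ _) fun l _ hl => ?_).trans ?_
    · rw [Multiset.mem_toFinset] at hl
      rw [Multiset.count_eq_zero_of_notMem hl, pow_zero]
    · simp

/-- The generating function `∑ h_f t^f` is the inverse of `∏ (1 - Y_l t)`. -/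
theorem mk_hsym_mul_prod {c : ℕ} (Y : Fin c → ℂ) :
    (PowerSeries.mk fun f => hsym f Y) *
      ∏ l, (1 - PowerSeries.C (Y l) * PowerSeries.X) = 1 := by
  rw [mk_hsym_eq_prod, ← Finset.prod_mul_distrib]
  exact Finset.prod_eq_one fun l _ => mk_pow_mul_one_sub (Y l)

/-- The negation matches the sign convention `∏_{i<k} (X_i - X_k)` of `vdm` with the opposite one of
`Matrix.det_vandermonde`. -/
theorem vdm_eq_det {c : ℕ} (X : Fin c → ℂ) :
    vdm X = (Matrix.vandermonde fun i => -X i).det := by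
  rw [Matrix.det_vandermonde, vdm]
  refine Finset.prod_congr rfl fun i _ => Finset.prod_congr rfl fun k _ => ?_
  ring

theorem vdm_ne_zero {c : ℕ} {X : Fin c → ℂ} (hX : Function.Injective X) : vdm X ≠ 0 := by
  rw [vdm_eq_det, Matrix.det_vandermonde_ne_zero_iff]
  exact neg_injective.comp hX

/-- Lagrange interpolation of `x ^ m` at the nodes `X_l`, evaluated at `x = 1`. The quotients of
Vandermonde products are the values at `1` of the Lagrange basis, and they arise here from Cramer's
rule for the transposed Vandermonde system. -/
theorem sum_vdm_div_mul_pow {c : ℕ} {X : Fin c → ℂ} (hX : Function.Injective X) {m : ℕ}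
    (hm : m < c) : ∑ l, vdm (Function.update X l 1) / vdm X * X l ^ m = 1 := by
  set A := Matrix.vandermonde fun i => -X i with hA
  have hcr : ∀ l, vdm (Function.update X l 1) =
      Matrix.cramer A.transpose (fun k => (-1) ^ (k : ℕ)) l := by
    intro l
    rw [Matrix.cramer_transpose_apply, vdm_eq_det]
    congr 1
    ext i k
    by_cases h : i = l
    · subst h; simp [Matrix.vandermonde_apply]
    · simp [Matrix.vandermonde_apply, h, hA]
  have h := congrFun (Matrix.mulVec_cramer A.transpose fun k => (-1) ^ (k : ℕ)) ⟨m, hm⟩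
  simp only [Matrix.mulVec, dotProduct, Matrix.transpose_apply, Matrix.det_transpose, ← hcr,
    Pi.smul_apply, smul_eq_mul] at h
  rw [hA, ← vdm_eq_det] at h
  simp only [Matrix.vandermonde_apply, neg_pow (X _)] at h
  have h1 : ((-1 : ℂ) ^ m) ≠ 0 := by simp
  simp only [mul_assoc, ← Finset.mul_sum] at h
  rw [mul_comm (vdm X)] at h
  have h2 := mul_left_cancel₀ h1 h
  simp only [div_mul_eq_mul_div, ← Finset.sum_div]
  rw [div_eq_one_iff_eq (vdm_ne_zero hX), ← h2]
  exact Finset.sum_congr rfl fun l _ => mul_comm _ _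

open Polynomial in
/-- If weights `α` integrate every `x ^ m` with `m < c` to `1` over the nodes `X`, then the defect
at `x ^ (c + j)` is a partial sum of complete homogeneous symmetric polynomials. The generating
function of all defects is a rational function with denominator `(1 - t) ∏ (1 - X_l t)`; its
numerator has degree at most `c` and is divisible by `t ^ c`, so it is the monomial
`∏ (1 - X_l) t ^ c`. -/
theorem one_sub_sum_eq_sum_hsym_mul_prod {c : ℕ} {X α : Fin c → ℂ}
    (hα : ∀ m < c, ∑ l, α l * X l ^ m = 1) (j : ℕ) :
    1 - ∑ l, α l * X l ^ (c + j) =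
      (∑ f ∈ Finset.range (j + 1), hsym f X) * ∏ l, (1 - X l) := by
  set a : ℕ → ℂ := fun n => 1 - ∑ l, α l * X l ^ n with ha
  set D : ℂ[X] := ∏ l, (1 - C (X l) * Polynomial.X) with hD
  set N : ℂ[X] := D - (1 - Polynomial.X) *
    ∑ l, C (α l) * ∏ i ∈ Finset.univ.erase l, (1 - C (X i) * Polynomial.X) with hN
  have hlin : ∀ i, natDegree (1 - C (X i) * Polynomial.X) ≤ 1 := fun i => by
    compute_degree
  have hdeg : N.natDegree ≤ c := by
    refine (natDegree_sub_le _ _).trans (max_le ?_ ?_)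
    · refine (natDegree_prod_le _ _).trans ((Finset.sum_le_sum fun i _ => hlin i).trans ?_)
      simp
    · rw [Finset.mul_sum]
      refine natDegree_sum_le_of_forall_le _ _ fun l _ => ?_
      refine natDegree_mul_le.trans ?_
      have h1 : natDegree (1 - Polynomial.X : ℂ[X]) ≤ 1 := by compute_degree
      have h2 : natDegree (C (α l) * ∏ i ∈ Finset.univ.erase l, (1 - C (X i) * Polynomial.X))
          ≤ c - 1 := by
        refine (natDegree_C_mul_le _ _).trans ((natDegree_prod_le _ _).trans
          ((Finset.sum_le_sum fun i _ => hlin i).trans ?_))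
        simp [Finset.card_erase_of_mem]
      have := l.pos
      omega
  have hDps : (D : PowerSeries ℂ) = ∏ l, (1 - PowerSeries.C (X l) * PowerSeries.X) := by
    rw [hD, ← Polynomial.coeToPowerSeries.ringHom_apply, map_prod]
    simp
  -- clearing denominators in the generating function of `a`
  have hNps : (PowerSeries.mk a) * ((1 - PowerSeries.X) * (D : PowerSeries ℂ)) =
      (N : PowerSeries ℂ) := by
    have h1 : PowerSeries.mk a = PowerSeries.mk 1 -
        ∑ l, PowerSeries.C (α l) * PowerSeries.mk fun k => X l ^ k := by
      ext n; simp [ha]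
    have h2 : (N : PowerSeries ℂ) = (D : PowerSeries ℂ) - (1 - PowerSeries.X) *
        ∑ l, PowerSeries.C (α l) *
          ∏ i ∈ Finset.univ.erase l, (1 - PowerSeries.C (X i) * PowerSeries.X) := by
      rw [hN, ← Polynomial.coeToPowerSeries.ringHom_apply, map_sub, map_mul, map_sum]
      simp only [map_mul, map_prod]
      simp
    rw [h1, h2, sub_mul, ← mul_assoc, PowerSeries.mk_one_mul_one_sub_eq_one, one_mul,
      mul_left_comm, Finset.sum_mul]
    congr 2
    refine Finset.sum_congr rfl fun l _ => ?_
    rw [hDps, ← Finset.mul_prod_erase _ _ (Finset.mem_univ l), mul_assoc,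
      ← mul_assoc (PowerSeries.mk _), mk_pow_mul_one_sub, one_mul]
  have hshift : PowerSeries.mk a = PowerSeries.X ^ c * PowerSeries.mk fun n => a (c + n) := by
    ext n
    rw [PowerSeries.coeff_X_pow_mul']
    split_ifs with h
    · simp [h]
    · simp [ha, hα n (by omega)]
  -- `N` is divisible by `t ^ c` and has degree at most `c`; the constant is its value at `1`
  have hNX : N = C (∏ l, (1 - X l)) * Polynomial.X ^ c := by
    have h1 : N = C (N.coeff c) * Polynomial.X ^ c := by
      ext n
      rw [coeff_C_mul_X_pow]
      split_ifs with h
      · rw [h]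
      · rcases lt_or_gt_of_ne h with h | h
        · rw [← Polynomial.coeff_coe, ← hNps, hshift, mul_assoc, PowerSeries.coeff_X_pow_mul',
            if_neg (by omega)]
        · exact coeff_eq_zero_of_natDegree_lt (by omega)
    have h2 : N.eval 1 = ∏ l, (1 - X l) := by
      simp [hN, hD, eval_prod]
    rw [h1, eval_mul, eval_C, eval_pow, eval_X, one_pow, mul_one] at h2
    rw [h1, h2]
  have key : (PowerSeries.mk fun n => a (c + n)) * ((1 - PowerSeries.X) * (D : PowerSeries ℂ)) =
      PowerSeries.C (∏ l, (1 - X l)) := by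
    have h1 := hNps
    rw [hshift, hNX, mul_assoc] at h1
    refine mul_left_cancel₀ (pow_ne_zero c PowerSeries.X_ne_zero) (h1.trans ?_)
    rw [Polynomial.coe_mul, Polynomial.coe_pow, Polynomial.coe_X, Polynomial.coe_C, mul_comm]
  have key2 : (PowerSeries.mk fun n => a (c + n)) =
      PowerSeries.C (∏ l, (1 - X l)) * ((PowerSeries.mk fun f => hsym f X) * PowerSeries.mk 1) := by
    rw [← key, hDps]
    have h1 := mk_hsym_mul_prod X
    have h2 := PowerSeries.mk_one_mul_one_sub_eq_one ℂ
    linear_combination (-(PowerSeries.mk fun n => a (c + n))) * h1 -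
      ((PowerSeries.mk fun n => a (c + n)) * (PowerSeries.mk fun f => hsym f X) *
        ∏ l, (1 - PowerSeries.C (X l) * PowerSeries.X)) * h2
  have := congrArg (PowerSeries.coeff j) key2
  rw [PowerSeries.coeff_mk, PowerSeries.coeff_C_mul, PowerSeries.coeff_mul,
    Finset.Nat.sum_antidiagonal_eq_sum_range_succ_mk] at this
  simp only [PowerSeries.coeff_mk, Pi.one_apply, mul_one] at this
  rw [mul_comm, ← this]

/-! ### Meander sums and the first-step recursion -/

/-- The sum of `weight p * g (final level of p)` over the meanders `p` with `n` steps that start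
at level `j`. Taking `g = 1` gives the total weight, and `g k = v ^ k` marks the (absolute) final
level by `v`. -/
noncomputable def meanderSum (S : Finset ℤ) (w g : ℤ → ℂ) (j n : ℕ) : ℂ :=
  ∑ p ∈ meanders S j n, weight w p * g (level j p n)

theorem level_zero {n : ℕ} (j : ℕ) (p : Fin n → ℤ) : level j p 0 = j := by
  simp [level]

theorem level_cons {n : ℕ} {j : ℕ} {b : ℤ} (h : 0 ≤ j + b) (p : Fin n → ℤ) (k : ℕ) :
    level j (Fin.cons b p : Fin (n + 1) → ℤ) (k + 1) = level (j + b).toNat p k := by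
  simp only [level, Finset.sum_filter, Fin.sum_univ_succ, Int.toNat_of_nonneg h]
  simp [add_assoc]

theorem mem_meanders {S : Finset ℤ} {j n : ℕ} {p : Fin n → ℤ} :
    p ∈ meanders S j n ↔ (∀ i, p i ∈ S) ∧ ∀ k ≤ n, 0 ≤ level j p k := by
  simp only [meanders, walks, Finset.mem_filter, Fintype.mem_piFinset]
  refine and_congr_right fun _ => ⟨fun h k hk => h ⟨k, by omega⟩, fun h k => h k (by omega)⟩

theorem cons_mem_meanders {S : Finset ℤ} {j n : ℕ} {b : ℤ} {p : Fin n → ℤ} :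
    (Fin.cons b p : Fin (n + 1) → ℤ) ∈ meanders S j (n + 1) ↔
      (b ∈ S ∧ 0 ≤ j + b) ∧ p ∈ meanders S (j + b).toNat n := by
  simp only [mem_meanders, Fin.forall_fin_succ, Fin.cons_zero, Fin.cons_succ]
  constructor
  · rintro ⟨⟨hb, hp⟩, h⟩
    have hjb : 0 ≤ (j : ℤ) + b := by
      have := h 1 (by omega)
      simpa [level, Finset.sum_filter, Fin.sum_univ_succ] using this
    exact ⟨⟨hb, hjb⟩, hp, fun k hk => level_cons hjb p k ▸ h (k + 1) (by omega)⟩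
  · rintro ⟨⟨hb, hjb⟩, hp, h⟩
    refine ⟨⟨hb, hp⟩, fun k hk => ?_⟩
    cases k with
    | zero => simp [level_zero]
    | succ k => rw [level_cons hjb]; exact h k (by omega)

theorem meanderSum_zero (S : Finset ℤ) (w g : ℤ → ℂ) (j : ℕ) : meanderSum S w g j 0 = g j := by
  have : meanders S j 0 = Finset.univ := by
    ext p
    simp only [mem_meanders, Finset.mem_univ, iff_true]
    exact ⟨fun i => i.elim0, fun k hk => by simp [Nat.le_zero.1 hk, level_zero]⟩
  simp [meanderSum, this, weight, level_zero]

/-- Decomposition of a meander by its first step, which moves the starting level from `j` to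
`j + b`. -/
theorem meanderSum_succ (S : Finset ℤ) (w g : ℤ → ℂ) (j n : ℕ) :
    meanderSum S w g j (n + 1) =
      ∑ b ∈ S with 0 ≤ (j : ℤ) + b, w b * meanderSum S w g (j + b).toNat n := by
  simp only [meanderSum, Finset.mul_sum]
  rw [Finset.sum_sigma']
  symm
  refine Finset.sum_bij' (fun x _ => (Fin.cons x.1 x.2 : Fin (n + 1) → ℤ))
    (fun p _ => ⟨p 0, Fin.tail p⟩) ?_ ?_ ?_ ?_ ?_
  · rintro ⟨b, p⟩ h
    simp only [Finset.mem_sigma, Finset.mem_filter] at h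
    exact cons_mem_meanders.2 h
  · intro p hp
    rw [← Fin.cons_self_tail p, cons_mem_meanders] at hp
    simpa only [Finset.mem_sigma, Finset.mem_filter] using hp
  · rintro ⟨b, p⟩ _
    simp
  · intro p _
    exact Fin.cons_self_tail p
  · rintro ⟨b, p⟩ h
    simp only [Finset.mem_sigma, Finset.mem_filter] at h
    rw [level_cons h.1.2]
    simp [weight, Fin.prod_univ_succ, mul_assoc]

/-- Growth of meander sums for a function `g` bounded by a multiple of `r ^ k + 1`. The summand `1`
accounts for the powers of the small roots in the solution of the recursion for `v`; it saves a
comparison of `‖X_l‖` with `‖v‖`. -/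
theorem norm_meanderSum_le (S : Finset ℤ) (w : ℤ → ℂ) {g : ℤ → ℂ} {r K : ℝ} (hr : 0 < r)
    (hK : 0 ≤ K) (hg : ∀ k : ℕ, ‖g k‖ ≤ K * (r ^ k + 1)) (n j : ℕ) :
    ‖meanderSum S w g j n‖ ≤
      K * (r ^ j * (∑ b ∈ S, ‖w b‖ * r ^ b) ^ n + (∑ b ∈ S, ‖w b‖) ^ n) := by
  induction n generalizing j with
  | zero => simpa [meanderSum_zero] using hg j
  | succ n ih =>
    set B := ∑ b ∈ S, ‖w b‖ * r ^ b with hB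
    set A := ∑ b ∈ S, ‖w b‖ with hA
    have hB0 : 0 ≤ B := Finset.sum_nonneg fun b _ => by positivity
    have hA0 : 0 ≤ A := Finset.sum_nonneg fun b _ => by positivity
    rw [meanderSum_succ]
    calc _ ≤ ∑ b ∈ S with 0 ≤ (j : ℤ) + b, ‖w b‖ * (K * (r ^ ((j : ℤ) + b) * B ^ n + A ^ n)) := by
          refine norm_sum_le_of_le _ fun b hb => ?_
          rw [norm_mul]
          have h := ih ((j : ℤ) + b).toNat
          rw [← zpow_natCast, Int.toNat_of_nonneg (Finset.mem_filter.1 hb).2] at h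
          gcongr
      _ ≤ ∑ b ∈ S, ‖w b‖ * (K * (r ^ ((j : ℤ) + b) * B ^ n + A ^ n)) :=
          Finset.sum_le_sum_of_subset_of_nonneg (Finset.filter_subset _ _) fun b _ _ => by
            positivity
      _ = K * (r ^ j * B ^ n * (∑ b ∈ S, ‖w b‖ * r ^ b) + A ^ n * ∑ b ∈ S, ‖w b‖) := by
          rw [Finset.mul_sum, Finset.mul_sum, ← Finset.sum_add_distrib, Finset.mul_sum]
          refine Finset.sum_congr rfl fun b _ => ?_
          rw [zpow_add₀ hr.ne', zpow_natCast]
          ring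
      _ = _ := by rw [← hB, ← hA]; ring

/-- Iterating the recursion `G j = g j + z ∑ w_b G (j + b)` over the first `N` steps: the error
term is the same meander sum with `G` in place of `g`. -/
theorem sum_range_meanderSum {S : Finset ℤ} {w g G : ℤ → ℂ} {z : ℂ}
    (hG : ∀ j : ℕ, G j = g j + z * ∑ b ∈ S with 0 ≤ (j : ℤ) + b, w b * G (j + b)) (N j : ℕ) :
    ∑ n ∈ Finset.range N, meanderSum S w g j n * z ^ n =
      G j - meanderSum S w G j N * z ^ N := by
  induction N generalizing j with
  | zero => simp [meanderSum_zero]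
  | succ N ih =>
    have hrec : ∑ n ∈ Finset.range N, meanderSum S w g j (n + 1) * z ^ (n + 1) =
        z * ∑ b ∈ S with 0 ≤ (j : ℤ) + b,
          w b * (G (j + b) - meanderSum S w G ((j : ℤ) + b).toNat N * z ^ N) := by
      simp only [meanderSum_succ, Finset.sum_mul]
      rw [Finset.sum_comm, Finset.mul_sum]
      refine Finset.sum_congr rfl fun b hb => ?_
      have h := ih ((j : ℤ) + b).toNat
      rw [Int.toNat_of_nonneg (Finset.mem_filter.1 hb).2] at h
      rw [← h, Finset.mul_sum, Finset.mul_sum]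
      refine Finset.sum_congr rfl fun n _ => ?_
      ring
    rw [Finset.sum_range_succ', hrec, meanderSum_zero, meanderSum_succ, hG j]
    simp only [mul_sub, Finset.sum_sub_distrib, Finset.sum_mul, Finset.mul_sum]
    have : ∀ b, z * (w b * (meanderSum S w G ((j : ℤ) + b).toNat N * z ^ N)) =
      w b * meanderSum S w G ((j : ℤ) + b).toNat N * z ^ (N + 1) := fun b => by ring
    simp only [this]
    ring

/-- A solution `G` of moderate growth of `G j = g j + z ∑ w_b G (j + b)`, the sum being over the
steps that stay nonnegative, is the generating function of the meander sums of `g`. -/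
theorem hasSum_meanderSum {S : Finset ℤ} {w g G : ℤ → ℂ} {z : ℂ} {r K : ℝ} (hr : 0 < r)
    (hzr : ‖z‖ * ∑ b ∈ S, ‖w b‖ * r ^ b < 1) (hz : ‖z‖ * ∑ b ∈ S, ‖w b‖ < 1)
    (hG : ∀ j : ℕ, G j = g j + z * ∑ b ∈ S with 0 ≤ (j : ℤ) + b, w b * G (j + b))
    (hgK : ∀ k : ℕ, ‖g k‖ ≤ r ^ k) (hGK : ∀ k : ℕ, ‖G k‖ ≤ K * (r ^ k + 1)) (j : ℕ) :
    HasSum (fun n => meanderSum S w g j n * z ^ n) (G j) := by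
  set B := ∑ b ∈ S, ‖w b‖ * r ^ b with hB
  set A := ∑ b ∈ S, ‖w b‖ with hA
  have hB0 : 0 ≤ B := Finset.sum_nonneg fun b _ => by positivity
  have hA0 : 0 ≤ A := Finset.sum_nonneg fun b _ => by positivity
  have hK : 0 ≤ K := by
    have := (norm_nonneg _).trans (hGK 0)
    simp only [pow_zero] at this
    linarith
  have hbound : ∀ (L : ℝ) (f : ℤ → ℂ), 0 ≤ L → (∀ k : ℕ, ‖f k‖ ≤ L * (r ^ k + 1)) → ∀ n,
      ‖meanderSum S w f j n * z ^ n‖ ≤ L * (r ^ j * (‖z‖ * B) ^ n + (‖z‖ * A) ^ n) := by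
    intro L f hL hf n
    rw [norm_mul, norm_pow]
    calc _ ≤ L * (r ^ j * B ^ n + A ^ n) * ‖z‖ ^ n := by
          gcongr
          exact norm_meanderSum_le S w hr hL hf n j
      _ = _ := by rw [mul_pow, mul_pow]; ring
  have hgeom : ∀ L : ℝ, Summable fun n => L * (r ^ j * (‖z‖ * B) ^ n + (‖z‖ * A) ^ n) := fun L =>
    (((summable_geometric_of_lt_one (by positivity) hzr).mul_left _).add
      (summable_geometric_of_lt_one (by positivity) hz)).mul_left L
  have hsum : Summable fun n => meanderSum S w g j n * z ^ n :=
    Summable.of_norm_bounded (hgeom 1) (hbound 1 g zero_le_one fun k => by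
      linarith [hgK k])
  rw [hsum.hasSum_iff_tendsto_nat]
  simp only [sum_range_meanderSum hG]
  have : Filter.Tendsto (fun n => meanderSum S w G j n * z ^ n) Filter.atTop (nhds 0) :=
    squeeze_zero_norm (hbound K G hK hGK) (hgeom K).tendsto_atTop_zero
  simpa using tendsto_const_nhds.sub this

/-! ### Counting the small roots of `x ^ c = z Q(x)` -/

theorem encard_pow_eq {c : ℕ} (hc : c ≠ 0) {z : ℂ} (hz : z ≠ 0) :
    {u : ℂ | u ^ c = z}.encard = c := by
  have hζ := Complex.isPrimitiveRoot_exp c hc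
  obtain ⟨α, hα⟩ := IsAlgClosed.exists_pow_nat_eq z (Nat.pos_of_ne_zero hc)
  have hcard := hζ.card_nthRoots z
  rw [if_pos ⟨α, hα⟩] at hcard
  have hnd : (Polynomial.nthRoots c z).Nodup := hζ.nthRoots_nodup hz
  have : {u : ℂ | u ^ c = z} = ((Polynomial.nthRoots c z).toFinset : Set ℂ) := by
    ext u
    simp [Polynomial.mem_nthRoots (Nat.pos_of_ne_zero hc)]
  rw [this, Set.encard_coe_eq_coe_finsetCard, Multiset.toFinset_card_of_nodup hnd, hcard]

/-- For small `z ≠ 0` the equation `x ^ c = z Q(x)` with `Q(0) ≠ 0` has exactly `c` roots in the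
punctured unit disc. With `φ(x) = x / Q(x) ^ (1 / c)`, a local homeomorphism at `0`, it reads
`φ(x) ^ c = z`, so `φ` maps the roots bijectively to the `c`-th roots of `z`. -/
theorem exists_encard_roots_eq {c : ℕ} (hc : c ≠ 0) {Q : ℂ → ℂ} {Q' : ℂ}
    (hQ : HasStrictDerivAt Q Q' 0) (hQ0 : Q 0 ≠ 0) {A : ℝ}
    (hA : ∀ x, ‖x‖ < 1 → ‖Q x‖ ≤ A) :
    ∃ δ : ℝ, 0 < δ ∧ ∀ z : ℂ, 0 < ‖z‖ → ‖z‖ < δ →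
      {x : ℂ | x ≠ 0 ∧ ‖x‖ < 1 ∧ x ^ c = z * Q x}.encard = c := by
  obtain ⟨a, ha⟩ := IsAlgClosed.exists_pow_nat_eq (Q 0) (Nat.pos_of_ne_zero hc)
  have ha0 : a ≠ 0 := by
    rintro rfl
    rw [zero_pow hc] at ha
    exact hQ0 ha.symm
  -- `k` is a branch of `(1 / Q) ^ (1 / c)` near `0`, normalised to avoid the cut of the logarithm
  set k : ℂ → ℂ := fun x => a⁻¹ * (Q 0 / Q x) ^ ((c : ℂ)⁻¹) with hk
  have hkc : ∀ x, k x ^ c = (Q x)⁻¹ := fun x => by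
    rw [hk]
    simp only
    rw [mul_pow, Complex.cpow_nat_inv_pow _ hc, inv_pow, ha]
    field_simp
  have hk0 : k 0 ≠ 0 := by
    intro h
    have := hkc 0
    rw [h, zero_pow hc] at this
    exact inv_ne_zero hQ0 this.symm
  have hkd : ∃ k', HasStrictDerivAt k k' 0 := by
    have h1 : HasStrictDerivAt (fun x => Q 0 / Q x) _ 0 :=
      (hasStrictDerivAt_const (0 : ℂ) (Q 0)).div hQ hQ0
    exact ⟨_, (h1.cpow (hasStrictDerivAt_const (0 : ℂ) ((c : ℂ)⁻¹))
      (by rw [div_self hQ0]; exact Complex.one_mem_slitPlane)).const_mul a⁻¹⟩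
  obtain ⟨k', hkd⟩ := hkd
  have hφ : HasStrictDerivAt (fun x => x * k x) (k 0) 0 := by
    have h := (hasStrictDerivAt_id (0 : ℂ)).mul hkd
    rw [one_mul, id, zero_mul, add_zero] at h
    exact h
  set φ : ℂ → ℂ := fun x => x * k x with hφdef
  have hF := hφ.hasStrictFDerivAt_equiv hk0
  set e := hF.toOpenPartialHomeomorph φ with he
  have hφ0 : φ 0 = 0 := by simp [hφdef]
  have hU : {x : ℂ | ‖x‖ < 1 ∧ Q x ≠ 0} ∈ nhds (0 : ℂ) := by
    refine Filter.inter_mem ?_ (hQ.hasDerivAt.continuousAt.eventually_ne hQ0)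
    filter_upwards [Metric.ball_mem_nhds (0 : ℂ) one_pos] with x hx
    exact mem_ball_zero_iff.1 hx
  obtain ⟨ρ, hρ, hρU⟩ := Metric.mem_nhds_iff.1
    (Filter.inter_mem (e.open_source.mem_nhds hF.mem_toOpenPartialHomeomorph_source) hU)
  have himg : φ '' (Metric.ball 0 ρ) ∈ nhds (0 : ℂ) := by
    have := hF.map_nhds_eq_of_equiv
    rw [hφ0] at this
    rw [← this]
    exact Filter.image_mem_map (Metric.ball_mem_nhds 0 hρ)
  obtain ⟨ε, hε, hεU⟩ := Metric.mem_nhds_iff.1 himg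
  have hA0 : 0 ≤ A := (norm_nonneg _).trans (hA 0 (by simp))
  refine ⟨min (ρ ^ c / (A + 1)) (ε ^ c), by positivity, fun z hz0 hz => ?_⟩
  have hz1 := (lt_min_iff.1 hz).1
  have hz2 := (lt_min_iff.1 hz).2
  rw [lt_div_iff₀ (by positivity)] at hz1
  have hφc : ∀ x, Q x ≠ 0 → (φ x ^ c = z ↔ x ^ c = z * Q x) := fun x hx => by
    simp only [hφdef]
    rw [mul_pow, hkc, ← div_eq_mul_inv, div_eq_iff hx]
  -- the bound on `Q` forces every root in the unit disc into the disc where `φ` is injective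
  have hball : ∀ x ∈ {x : ℂ | x ≠ 0 ∧ ‖x‖ < 1 ∧ x ^ c = z * Q x}, x ∈ Metric.ball (0 : ℂ) ρ := by
    rintro x ⟨_, hx1, hx⟩
    rw [mem_ball_zero_iff]
    refine lt_of_pow_lt_pow_left₀ c hρ.le ?_
    calc ‖x‖ ^ c = ‖z‖ * ‖Q x‖ := by rw [← norm_pow, hx, norm_mul]
      _ ≤ ‖z‖ * (A + 1) := by gcongr; linarith [hA x hx1]
      _ < ρ ^ c := hz1
  have hbij : Set.BijOn φ {x : ℂ | x ≠ 0 ∧ ‖x‖ < 1 ∧ x ^ c = z * Q x} {u : ℂ | u ^ c = z} := by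
    refine ⟨fun x hx => (hφc x (hρU (hball x hx)).2.2).2 hx.2.2, fun x hx y hy hxy => ?_,
      fun u hu => ?_⟩
    · exact e.injOn (hρU (hball x hx)).1 (hρU (hball y hy)).1 hxy
    · have hu' : u ∈ Metric.ball (0 : ℂ) ε := by
        rw [mem_ball_zero_iff]
        refine lt_of_pow_lt_pow_left₀ c hε.le ?_
        rw [← norm_pow, show u ^ c = z from hu]
        exact hz2
      obtain ⟨x, hx, rfl⟩ := hεU hu'
      refine ⟨x, ⟨?_, (hρU hx).2.1, (hφc x (hρU hx).2.2).1 hu⟩, rfl⟩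
      rintro rfl
      rw [Set.mem_ofPred_eq, hφ0, zero_pow hc] at hu
      rw [← hu, norm_zero] at hz0
      exact lt_irrefl _ hz0
  rw [← hbij.injOn.encard_image, hbij.image_eq, encard_pow_eq hc (norm_pos_iff.1 hz0)]

/-! ### The kernel method for lattice paths -/

theorem norm_charP_le (S : Finset ℤ) (w : ℤ → ℂ) (x : ℂ) :
    ‖charP S w x‖ ≤ ∑ b ∈ S, ‖w b‖ * ‖x‖ ^ b := by
  refine norm_sum_le_of_le _ fun b _ => ?_
  rw [norm_mul, norm_zpow]

theorem one_sub_mul_charP_ne_zero {S : Finset ℤ} {w : ℤ → ℂ} {z x : ℂ}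
    (h : ‖z‖ * ∑ b ∈ S, ‖w b‖ * ‖x‖ ^ b < 1) : 1 - z * charP S w x ≠ 0 := by
  intro h0
  have h1 : ‖z * charP S w x‖ = 1 := by rw [← sub_eq_zero.1 h0, norm_one]
  rw [norm_mul] at h1
  have := mul_le_mul_of_nonneg_left (norm_charP_le S w x) (norm_nonneg z)
  linarith

theorem sum_mul_zpow_add (S : Finset ℤ) (w : ℤ → ℂ) {x : ℂ} (hx : x ≠ 0) (k : ℤ) :
    ∑ b ∈ S, w b * x ^ (k + b) = x ^ k * charP S w x := by
  rw [charP, Finset.mul_sum]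
  refine Finset.sum_congr rfl fun b _ => ?_
  rw [zpow_add₀ hx]
  ring

/-- This holds also when all steps are positive and `depth` truncates to `0`. -/
theorem neg_depth_le {S : Finset ℤ} (hS : S.Nonempty) {b : ℤ} (hb : b ∈ S) :
    -(depth S hS : ℤ) ≤ b := by
  have := S.min'_le b hb
  unfold depth
  omega

theorem hasSum_walkGF {S : Finset ℤ} {w : ℤ → ℂ} {z : ℂ} (hz : ‖z‖ * ∑ b ∈ S, ‖w b‖ < 1) :
    HasSum (fun n : ℕ => PowerSeries.coeff n (walkGF S w) * z ^ n)
      (1 / (1 - z * charP S w 1)) := by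
  have hcoeff : ∀ n, PowerSeries.coeff n (walkGF S w) * z ^ n = (z * charP S w 1) ^ n := by
    intro n
    simp only [walkGF, PowerSeries.coeff_mk, walks, weight, charP, one_zpow, mul_one]
    rw [← Finset.prod_univ_sum, Finset.prod_const, Finset.card_univ, Fintype.card_fin, mul_pow,
      mul_comm]
  simp only [hcoeff, one_div]
  refine hasSum_geometric_of_norm_lt_one (lt_of_le_of_lt ?_ hz)
  rw [norm_mul]
  gcongr
  simpa using norm_charP_le S w 1

/-- The kernel method. The function `v ^ k`, corrected by a combination of the `X_l ^ k`, solves the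
unrestricted recursion because `z P(X_l) = 1`, and the interpolation property of `α` makes it vanish
on the levels `-c ≤ k < 0`, so that it solves the recursion restricted to nonnegative levels. -/
theorem hasSum_meanderSum_zpow {S : Finset ℤ} {w : ℤ → ℂ} {z v : ℂ} {c : ℕ}
    (hc : ∀ b ∈ S, -(c : ℤ) ≤ b) {X α : Fin c → ℂ} (hX : ∀ l, X l ∈ smallRoots S w z)
    (hv : v ≠ 0) (hα : ∀ m < c, ∑ l, α l * (X l / v) ^ m = 1)
    (hzv : ‖z‖ * ∑ b ∈ S, ‖w b‖ * ‖v‖ ^ b < 1) (hz : ‖z‖ * ∑ b ∈ S, ‖w b‖ < 1) (j : ℕ) :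
    HasSum (fun n => meanderSum S w (fun k => v ^ k) j n * z ^ n)
      (v ^ j * (1 / (1 - z * charP S w v) * (1 - ∑ l, α l * (X l / v) ^ (c + j)))) := by
  have hP := one_sub_mul_charP_ne_zero hzv
  set κ := 1 / (1 - z * charP S w v) with hκ
  set G : ℤ → ℂ := fun k => κ * (v ^ k - (v ^ c)⁻¹ * ∑ l, α l * X l ^ (c + k)) with hG
  -- whenever `c + k` is a natural number, `G k` is a multiple of an interpolation defect
  have hGnat : ∀ (k : ℤ) (m : ℕ), (c : ℤ) + k = m →
      G k = v ^ k * (κ * (1 - ∑ l, α l * (X l / v) ^ m)) := by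
    intro k m hm
    have h1 : v ^ k * v ^ c = v ^ m := by
      rw [← zpow_natCast, ← zpow_natCast, ← zpow_add₀ hv, ← hm, add_comm]
    simp only [hG, hm, zpow_natCast, div_pow, ← mul_div_assoc, ← Finset.sum_div]
    rw [← h1]
    field_simp
  have hG0 : ∀ k : ℤ, -(c : ℤ) ≤ k → k < 0 → G k = 0 := by
    intro k hk hk0
    rw [hGnat k ((c : ℤ) + k).toNat (by omega), hα _ (by omega), sub_self, mul_zero, mul_zero]
  have hrec : ∀ j : ℕ,
      G j = v ^ (j : ℤ) + z * ∑ b ∈ S with 0 ≤ (j : ℤ) + b, w b * G (j + b) := by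
    intro j
    -- a step of depth at most `c` from level `j ≥ 0` leads at worst to a level where `G` vanishes
    have h1 : ∑ b ∈ S with 0 ≤ (j : ℤ) + b, w b * G (j + b) = ∑ b ∈ S, w b * G (j + b) := by
      refine Finset.sum_filter_of_ne fun b hb h => ?_
      by_contra hneg
      have := hc b hb
      exact h (by rw [hG0 _ (by omega) (by omega), mul_zero])
    have h2 : ∑ b ∈ S, w b * G (j + b) = κ * (v ^ (j : ℤ) * charP S w v -
        (v ^ c)⁻¹ * ∑ l, α l * (X l ^ ((c : ℤ) + j) * charP S w (X l))) := by
      simp only [← sum_mul_zpow_add S w (hX _).1, ← sum_mul_zpow_add S w hv, Finset.mul_sum, hG]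
      rw [Finset.sum_comm, ← Finset.sum_sub_distrib, Finset.mul_sum]
      refine Finset.sum_congr rfl fun b _ => ?_
      simp only [mul_sub, Finset.mul_sum]
      congr 1
      · ring
      · refine Finset.sum_congr rfl fun l _ => ?_
        rw [add_assoc]
        ring
    have h3 : z * ∑ l, α l * (X l ^ ((c : ℤ) + j) * charP S w (X l)) =
        ∑ l, α l * X l ^ ((c : ℤ) + j) := by
      rw [Finset.mul_sum]
      refine Finset.sum_congr rfl fun l _ => ?_
      linear_combination (-(α l * X l ^ ((c : ℤ) + j))) * (hX l).2.2
    have h4 : κ * (1 - z * charP S w v) = 1 := by rw [hκ]; field_simp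
    rw [h1, h2]
    simp only [hG]
    linear_combination (v ^ (j : ℤ)) * h4 + κ * (v ^ c)⁻¹ * h3
  have hbound : ∀ k : ℕ,
      ‖G k‖ ≤ ‖κ‖ * (1 + ‖(v ^ c)⁻¹‖ * ∑ l, ‖α l‖) * (‖v‖ ^ k + 1) := by
    intro k
    have h1 : ‖∑ l, α l * X l ^ ((c : ℤ) + k)‖ ≤ ∑ l, ‖α l‖ := by
      refine norm_sum_le_of_le _ fun l _ => ?_
      rw [norm_mul, ← Nat.cast_add, zpow_natCast, norm_pow]
      exact mul_le_of_le_one_right (norm_nonneg _) (pow_le_one₀ (norm_nonneg _) (hX l).2.1.le)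
    have h2 : 0 ≤ ∑ l, ‖α l‖ := Finset.sum_nonneg fun l _ => norm_nonneg _
    simp only [hG]
    rw [norm_mul, mul_assoc]
    gcongr
    calc _ ≤ ‖v ^ (k : ℤ)‖ + ‖(v ^ c)⁻¹ * ∑ l, α l * X l ^ ((c : ℤ) + k)‖ := norm_sub_le _ _
      _ ≤ ‖v‖ ^ k + ‖(v ^ c)⁻¹‖ * ∑ l, ‖α l‖ := by
          rw [norm_mul, zpow_natCast, norm_pow]
          gcongr
      _ ≤ _ := by
          have h3 : 0 ≤ ‖v‖ ^ k := by positivity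
          have h4 : 0 ≤ ‖(v ^ c)⁻¹‖ * ∑ l, ‖α l‖ := by positivity
          nlinarith [mul_nonneg h3 h4]
  have := hasSum_meanderSum (norm_pos_iff.2 hv) hzv hz hrec (fun k => by simp) hbound j
  rwa [hGnat j (c + j) (by push_cast; ring), zpow_natCast] at this

theorem coeff_meanderGF (S : Finset ℤ) (w : ℤ → ℂ) (j n : ℕ) :
    PowerSeries.coeff n (meanderGF S w j) = meanderSum S w (fun k => 1 ^ k) j n := by
  simp [meanderGF, meanderSum]

theorem eval₂_coeff_meanderGF₂ (S : Finset ℤ) (w : ℤ → ℂ) (v : ℂˣ) (j n : ℕ) :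
    LaurentPolynomial.eval₂ (RingHom.id ℂ) v (PowerSeries.coeff n (meanderGF₂ S w j)) =
      ((v : ℂ) ^ j)⁻¹ * meanderSum S w (fun k => (v : ℂ) ^ k) j n := by
  simp only [meanderGF₂, PowerSeries.coeff_mk, map_sum, LaurentPolynomial.eval₂_C_mul_T,
    meanderSum, Finset.mul_sum]
  refine Finset.sum_congr rfl fun p _ => ?_
  rw [RingHom.id_apply, Units.val_zpow_eq_zpow_val, zpow_sub₀ v.ne_zero, zpow_natCast]
  ring

theorem exists_encard_smallRoots_eq (S : Finset ℤ) (hS : S.Nonempty) (w : ℤ → ℂ)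
    (hw : ∀ b ∈ S, w b ≠ 0) :
    ∃ δ : ℝ, 0 < δ ∧ ∀ z : ℂ, 0 < ‖z‖ → ‖z‖ < δ →
      (smallRoots S w z).encard = (depth S hS : ℕ∞) := by
  set c := depth S hS with hcdef
  set A := ∑ b ∈ S, ‖w b‖ with hA
  have hA0 : 0 ≤ A := Finset.sum_nonneg fun b _ => norm_nonneg _
  -- `Q(x) = x ^ c P(x)` is a polynomial; it is bounded by `A` on the unit disc
  set Q : ℂ → ℂ := fun x => ∑ b ∈ S, w b * x ^ (b + c).toNat with hQ
  have hQP : ∀ x, x ≠ 0 → Q x = x ^ c * charP S w x := by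
    intro x hx
    rw [← zpow_natCast, ← sum_mul_zpow_add S w hx]
    refine Finset.sum_congr rfl fun b hb => ?_
    have := neg_depth_le hS hb
    rw [← zpow_natCast, Int.toNat_of_nonneg (by omega), add_comm]
  have hQA : ∀ x, ‖x‖ < 1 → ‖Q x‖ ≤ A := fun x hx => norm_sum_le_of_le _ fun b _ => by
    rw [norm_mul, norm_pow]
    exact mul_le_of_le_one_right (norm_nonneg _) (pow_le_one₀ (norm_nonneg _) hx.le)
  have hset : ∀ z, smallRoots S w z = {x | x ≠ 0 ∧ ‖x‖ < 1 ∧ x ^ c = z * Q x} := by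
    intro z
    ext x
    refine and_congr_right fun hx => and_congr_right fun _ => ?_
    rw [hQP x hx, mul_left_comm]
    exact ((mul_eq_left₀ (pow_ne_zero c hx)).trans eq_comm).symm.trans eq_comm
  simp only [hset]
  rcases eq_or_ne c 0 with hc | hc
  · refine ⟨1 / (A + 1), by positivity, fun z _ hz => ?_⟩
    rw [lt_div_iff₀ (by positivity)] at hz
    rw [hc, Nat.cast_zero, Set.encard_eq_zero, Set.eq_empty_iff_forall_notMem]
    rintro x ⟨_, hx1, hx⟩
    have h1 := congrArg norm hx
    rw [pow_zero, norm_one, norm_mul] at h1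
    have := mul_le_mul_of_nonneg_left (hQA x hx1) (norm_nonneg z)
    nlinarith [norm_nonneg z]
  · have hQ0 : Q 0 ≠ 0 := by
      have hmin := S.min'_mem hS
      have hcm : (c : ℤ) = -S.min' hS := by
        rw [hcdef] at hc ⊢
        unfold depth at hc ⊢
        omega
      have : Q 0 = w (S.min' hS) := by
        simp only [hQ]
        rw [Finset.sum_eq_single_of_mem _ hmin fun b hb hne => ?_]
        · simp [hcm]
        · have := S.min'_le b hb
          rw [zero_pow (by omega), mul_zero]
      rw [this]
      exact hw _ hmin
    have hQd : HasStrictDerivAt Q (∑ b ∈ S, w b * ((b + c).toNat * 0 ^ ((b + c).toNat - 1))) 0 := by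
      simp only [hQ]
      exact HasStrictDerivAt.fun_sum fun b _ => (hasStrictDerivAt_pow _ _).const_mul _
    exact exists_encard_roots_eq hc hQd hQ0 hQA

end LatticePath

theorem mainTheorem6 (S : Finset ℤ) (hS : S.Nonempty) (w : ℤ → ℂ) (hw : ∀ b ∈ S, w b ≠ 0) :
    ∃ δ : ℝ, 0 < δ ∧ ∀ z : ℂ, 0 < ‖z‖ → ‖z‖ < δ →
      1 - z * LatticePath.charP S w 1 ≠ 0 ∧
      HasSum (fun n : ℕ => PowerSeries.coeff n (LatticePath.walkGF S w) * z ^ n)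
        (1 / (1 - z * LatticePath.charP S w 1)) ∧
      (LatticePath.smallRoots S w z).encard = (LatticePath.depth S hS : ℕ∞) ∧
      ∀ X : Fin (LatticePath.depth S hS) → ℂ, Function.Injective X →
        Set.range X = LatticePath.smallRoots S w z →
        -- the two expressions for the generating function of meanders starting at level `j`
        (∀ j : ℕ,
          HasSum (fun n : ℕ => PowerSeries.coeff n (LatticePath.meanderGF S w j) * z ^ n)
            (1 / (1 - z * LatticePath.charP S w 1) *
              (1 - ∑ l, LatticePath.vdm (Function.update X l 1) / LatticePath.vdm X *
                X l ^ (LatticePath.depth S hS + j))) ∧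
          HasSum (fun n : ℕ => PowerSeries.coeff n (LatticePath.meanderGF S w j) * z ^ n)
            (1 / (1 - z * LatticePath.charP S w 1) *
              ((∑ f ∈ Finset.range (j + 1), LatticePath.hsym f X) * ∏ l, (1 - X l)))) ∧
        -- the refinement in which `v` marks the level of the endpoint, and its case `j = 0`
        (∀ v : ℂˣ, ‖z‖ * ∑ b ∈ S, ‖w b‖ * ‖(v : ℂ)‖ ^ b < 1 →
          1 - z * LatticePath.charP S w v ≠ 0 ∧
          (∀ j : ℕ,
            HasSum (fun n : ℕ => LaurentPolynomial.eval₂ (RingHom.id ℂ) v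
                (PowerSeries.coeff n (LatticePath.meanderGF₂ S w j)) * z ^ n)
              (1 / (1 - z * LatticePath.charP S w v) *
                ((∑ f ∈ Finset.range (j + 1), LatticePath.hsym f (fun l => X l / v)) *
                  ∏ l, (1 - X l / v)))) ∧
          HasSum (fun n : ℕ => LaurentPolynomial.eval₂ (RingHom.id ℂ) v
              (PowerSeries.coeff n (LatticePath.meanderGF₂ S w 0)) * z ^ n)
            (1 / (1 - z * LatticePath.charP S w v) * ∏ l, (1 - X l / v))) := by

  obtain ⟨δ, hδ, hroots⟩ := LatticePath.exists_encard_smallRoots_eq S hS w hw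
  have hA0 : 0 ≤ ∑ b ∈ S, ‖w b‖ := Finset.sum_nonneg fun b _ => norm_nonneg _
  refine ⟨min δ (1 / (∑ b ∈ S, ‖w b‖ + 1)), by positivity, fun z hz0 hzδ => ?_⟩
  have hz : ‖z‖ * ∑ b ∈ S, ‖w b‖ < 1 := by
    have := (lt_min_iff.1 hzδ).2
    rw [lt_div_iff₀ (by positivity)] at this
    nlinarith
  have hz1 : ‖z‖ * ∑ b ∈ S, ‖w b‖ * ‖(1 : ℂ)‖ ^ b < 1 := by simpa using hz
  refine ⟨LatticePath.one_sub_mul_charP_ne_zero hz1, LatticePath.hasSum_walkGF hz,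
    hroots z hz0 (lt_min_iff.1 hzδ).1, fun X hXinj hXrange => ?_⟩
  have hX : ∀ l, X l ∈ LatticePath.smallRoots S w z := fun l => hXrange ▸ Set.mem_range_self l
  have hdepth := fun b (hb : b ∈ S) => LatticePath.neg_depth_le hS hb
  refine ⟨fun j => ?_, fun v hzv => ?_⟩
  · have hα := fun m (hm : m < LatticePath.depth S hS) =>
      LatticePath.sum_vdm_div_mul_pow hXinj hm
    have h := LatticePath.hasSum_meanderSum_zpow hdepth hX one_ne_zero
      (by simpa only [div_one] using hα) hz1 hz j
    simp only [one_pow, one_mul, div_one, ← LatticePath.coeff_meanderGF] at h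
    exact ⟨h, LatticePath.one_sub_sum_eq_sum_hsym_mul_prod hα j ▸ h⟩
  · have hYinj : Function.Injective fun l => X l / (v : ℂ) :=
      fun a b h => hXinj ((div_left_inj' v.ne_zero).1 h)
    have hα := fun m (hm : m < LatticePath.depth S hS) =>
      LatticePath.sum_vdm_div_mul_pow hYinj hm
    have key : ∀ j : ℕ,
        HasSum (fun n : ℕ => LaurentPolynomial.eval₂ (RingHom.id ℂ) v
            (PowerSeries.coeff n (LatticePath.meanderGF₂ S w j)) * z ^ n)
          (1 / (1 - z * LatticePath.charP S w v) *
            ((∑ f ∈ Finset.range (j + 1), LatticePath.hsym f (fun l => X l / v)) *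
              ∏ l, (1 - X l / v))) := by
      intro j
      have h := (LatticePath.hasSum_meanderSum_zpow hdepth hX v.ne_zero hα hzv hz j).mul_left
        ((v : ℂ) ^ j)⁻¹
      rw [inv_mul_cancel_left₀ (pow_ne_zero j v.ne_zero),
        LatticePath.one_sub_sum_eq_sum_hsym_mul_prod hα j] at h
      simpa only [LatticePath.eval₂_coeff_meanderGF₂, mul_assoc] using h
    refine ⟨LatticePath.one_sub_mul_charP_ne_zero hzv, key, ?_⟩
    simpa [LatticePath.hsym] using key 0
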